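/- Let $p,q,r,s$ be pairwise distinct primes and let $N=pqrs$. Let $\mathbb{Z}_N$ be the cyclic group of order $N$, put $\xi_N=e^{2\pi i/N}$, and let $S,\Lambda\subseteq\mathbb{Z}_N$. Suppose that $(S,\Lambda)$ is a spectral pair, that is, $|S|=|\Lambda|$ and $$\sum_{x\in S}\xi_N^{\lambda x}\,\overline{\xi_N^{\lambda' x}}=|S|\,\delta_{\lambda\lambda'}\qquad\text{for all }\lambda,\lambda'\in\Lambda.$$ For $A\subseteq\mathbb{Z}_N$ let $m_A(X)=\sum_{a\in A}X^a\in\mathbb{Q}[X]$ be its mask polynomial, where the exponents are the representatives of the elements of $A$ in $\{0,\dots,N-1\}$, and let $\Phi_N$ be the $N$-th cyclotomic polynomial. Call $A\subseteq\mathbb{Z}_N$ a tile if there is $T\subseteq\mathbb{Z}_N$ such that every element of $\mathbb{Z}_N$ can be written uniquely as $a+t$ with $a\in A$ and $t\in T$. Assume that $\Phi_N\nmid m_S$ and $\Phi_N\nmid m_\Lambda$ in $\mathbb{Q}[X]$. If $\Lambda$ is a tile, then $S$ is a tile. -/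

import Mathlib

open Polynomial

namespace FugledeCyclic

/-- The exponential function `e_l(x) = ξ_N ^ (l x)` on `ℤ/Nℤ`, with `ξ_N = exp (2πi/N)`;
Mathlib's `ZMod.stdAddChar` is the character `j ↦ exp (2πi j/N)`. -/
noncomputable def expFun {N : ℕ} [NeZero N] (l x : ZMod N) : ℂ :=
  ZMod.stdAddChar (l * x)

theorem expFun_eq {N : ℕ} [NeZero N] (l x : ZMod N) :
    expFun l x = Complex.exp (2 * Real.pi * Complex.I / N) ^ (l.val * x.val) := by
  have h : l * x = (((l.val * x.val : ℕ) : ℤ) : ZMod N) := by simp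
  rw [expFun, h, ZMod.stdAddChar_coe, ← Complex.exp_nat_mul]
  congr 1
  push_cast
  ring

/-- `(S, L)` is a spectral pair of `ℤ/Nℤ`: `|S| = |L|` and the exponentials `e_l`, `l ∈ L`,
satisfy `∑_{s ∈ S} e_l(s) conj(e_l'(s)) = |S| δ_{l l'}`. -/
def IsSpectralPair {N : ℕ} [NeZero N] (S L : Finset (ZMod N)) : Prop :=
  S.card = L.card ∧
    ∀ l ∈ L, ∀ l' ∈ L,
      ∑ s ∈ S, expFun l s * (starRingEnd ℂ) (expFun l' s) =
        if l = l' then (S.card : ℂ) else 0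

/-- `S` is a tile of `ℤ/Nℤ`: for some `T`, every element is uniquely `s + t` with
`s ∈ S` and `t ∈ T`. -/
def IsTile {N : ℕ} (S : Finset (ZMod N)) : Prop :=
  ∃ T : Finset (ZMod N), ∀ x : ZMod N,
    ∃! st : ZMod N × ZMod N, st.1 ∈ S ∧ st.2 ∈ T ∧ st.1 + st.2 = x

/-- The mask polynomial `∑_g f(g) x^g` of `f : ℤ/Nℤ → K`, where the exponent of `g` is its
representative in `{0, …, N - 1}`. -/
noncomputable def maskPolynomial {N : ℕ} [NeZero N] {K : Type*} [Field K] (f : ZMod N → K) :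
    K[X] :=
  ∑ g : ZMod N, C (f g) * X ^ g.val

/-- The mask polynomial `m_S` of a set `S`, i.e. that of its multiplicity function, over `ℚ`. -/
noncomputable def setMask {N : ℕ} [NeZero N] (S : Finset (ZMod N)) : ℚ[X] :=
  maskPolynomial (fun g => if g ∈ S then (1 : ℚ) else 0)

end FugledeCyclic

/-!
Write `k = |S| = |L|`. For squarefree `N`, a subset of `ℤ/Nℤ` whose size `k` divides `N` is a tile
if and only if its elements are distinct mod `k`. One direction is clear (`isTile_of_injOn_cast`),
the other follows from Tijdeman's theorem on dilating the complement of a tiling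
(`covers_image_smul`). So `L` is a complete residue system mod `k`, and the same has to be shown
for `S`.

Suppose that two elements of `S` are congruent mod `k`. Their difference is a zero of the Fourier
transform of the indicator of `L`, as the spectral pair relation is symmetric
(`IsSpectralPair.symm`); likewise, differences of elements of `L` are zeros of the transform of
the indicator of `S`. By Galois conjugation, such a vanishing depends only on the set `P` of
primes at which the frequency is nonzero, and it says that the multiplicities of the set over the
product of the `ℤ/l`, `l ∈ P`, have zero alternating sums over boxes (`VanishesOn.sub_indicator`):
they are constant for one prime and additive for two. Since `Φ_N ∤ m_S`, any two elements of `L`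
agree in at least one of the four prime coordinates. There remain three combinatorial problems, by
the number of primes dividing `k`.

* Three primes: the remaining prime would divide `k` (`injOn_cast_of_prime_index`).
* Two primes, `k = p q`: the multiplicities of `L` on `ℤ/r × ℤ/s` are additive, with a full row
  and a full column. Blocks of `L` in opposite quadrants with respect to these pairwise share a
  coordinate in `ℤ/p × ℤ/q`, so they are too small to fill it (`card_ne_mul_of_agree`).
* One prime, `k = p`: as `S` misses a class mod `p`, any two elements of `L` agree in exactly one
  of the other three coordinates, which contradicts additivity on two of them, and also the
  vanishing of box sums on all three (`injOn_cast_of_card_eq_prime`).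
-/

namespace FugledeCyclic

/-! ### Fourier transform and prime supports -/

section Fourier

/-- The primes `l ∣ N` for which the reduction of `t` mod `l` is nonzero. For squarefree `N` this
set determines the order of `t` in `ℤ/Nℤ`, which is the product of its elements. -/
def primeSupport {N : ℕ} (t : ZMod N) : Finset ℕ :=
  N.primeFactors.filter fun l => (t.cast : ZMod l) ≠ 0

theorem primeSupport_sub {N : ℕ} (x y : ZMod N) :
    primeSupport (x - y) = N.primeFactors.filter fun l => (x.cast : ZMod l) ≠ y.cast := by
  refine Finset.filter_congr fun l hl => ?_
  rw [ZMod.cast_sub (Nat.dvd_of_mem_primeFactors hl), Ne, sub_eq_zero]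

variable {N : ℕ} [NeZero N]

/-- The Fourier transform at the frequency `t` of the indicator function of `A`, without
normalization. -/
noncomputable def fourierSum (A : Finset (ZMod N)) (t : ZMod N) : ℂ :=
  ∑ a ∈ A, ZMod.stdAddChar (t * a)

/-- The Fourier transform of `g` vanishes at every frequency whose set of nonzero prime
coordinates is exactly `P`. -/
def VanishesOn (g : ZMod N → ℂ) (P : Finset ℕ) : Prop :=
  ∀ t : ZMod N, primeSupport t = P → ∑ x, g x * ZMod.stdAddChar (t * x) = 0

theorem IsSpectralPair.fourierSum_eq_zero {S L : Finset (ZMod N)} (h : IsSpectralPair S L)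
    {l l' : ZMod N} (hl : l ∈ L) (hl' : l' ∈ L) (hne : l ≠ l') : fourierSum S (l - l') = 0 := by
  have := h.2 l hl l' hl'
  rw [if_neg hne] at this
  rw [← this, fourierSum]
  refine Finset.sum_congr rfl fun s _ => ?_
  rw [expFun, expFun, ← AddChar.map_neg_eq_conj, ← AddChar.map_add_eq_mul]
  congr 1
  ring

/-- Being spectral is a symmetric relation: the rescaled matrix `(e_l(s))` is square with
orthonormal rows, hence also with orthonormal columns. -/
theorem IsSpectralPair.symm {S L : Finset (ZMod N)} (h : IsSpectralPair S L) :
    IsSpectralPair L S := by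
  refine ⟨h.1.symm, fun x hx y hy => ?_⟩
  classical
  have hS0 : (S.card : ℂ) ≠ 0 := by
    exact_mod_cast (Finset.card_pos.2 ⟨x, hx⟩).ne'
  let e : S ≃ L := Fintype.equivOfCardEq (by simpa using h.1)
  let M : Matrix L S ℂ := fun l s => expFun (l : ZMod N) (s : ZMod N)
  let M' : Matrix S L ℂ := fun s l =>
    (S.card : ℂ)⁻¹ * (starRingEnd ℂ) (expFun (l : ZMod N) (s : ZMod N))
  have h1 : M * M' = 1 := by
    ext l l'
    have := h.2 l l.2 l' l'.2
    rw [← Finset.sum_coe_sort] at this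
    rw [Matrix.mul_apply, Matrix.one_apply]
    have h2 : ∀ s : S, M l s * M' s l' = (S.card : ℂ)⁻¹ *
        (expFun (l : ZMod N) (s : ZMod N) * (starRingEnd ℂ) (expFun (l' : ZMod N) (s : ZMod N))) :=
      fun s => by simp only [M, M']; ring
    rw [Finset.sum_congr rfl fun s _ => h2 s, ← Finset.mul_sum, this]
    by_cases hll : l = l'
    · simp [hll, hS0]
    · have : (l : ZMod N) ≠ l' := fun h => hll (Subtype.ext h)
      simp [hll]
  have h3 : M' * M = 1 := (Matrix.mul_eq_one_comm_of_equiv e.symm).1 h1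
  have h4 := congrFun (congrFun h3 ⟨y, hy⟩) ⟨x, hx⟩
  rw [Matrix.mul_apply, Matrix.one_apply] at h4
  have h5 : ∀ l : L, M' ⟨y, hy⟩ l * M l ⟨x, hx⟩ = (S.card : ℂ)⁻¹ *
        (expFun x (l : ZMod N) * (starRingEnd ℂ) (expFun y (l : ZMod N))) := fun l => by
    simp only [M, M', expFun, mul_comm (l : ZMod N)]; ring
  rw [Finset.sum_congr rfl fun s _ => h5 s, ← Finset.mul_sum,
    Finset.sum_coe_sort L fun l => expFun x l * (starRingEnd ℂ) (expFun y l)] at h4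
  rw [inv_mul_eq_iff_eq_mul₀ hS0] at h4
  rw [h4, ← h.1]
  by_cases hxy : x = y
  · simp [hxy]
  · simp [hxy, Ne.symm hxy]

theorem stdAddChar_eq_pow (t : ZMod N) :
    (ZMod.stdAddChar t : ℂ) = Complex.exp (2 * Real.pi * Complex.I / N) ^ t.val := by
  have := expFun_eq (1 : ZMod N) t
  rw [expFun, one_mul] at this
  have h : t = ((t.val : ℕ) : ℤ) := by simp
  rw [h, ZMod.stdAddChar_coe, ← Complex.exp_nat_mul]
  congr 1
  push_cast
  simp
  ring

/-- The Fourier transform of `A` at `t` is the mask polynomial evaluated at the root of unity `ξ_N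
^ t`. -/
theorem aeval_setMask (A : Finset (ZMod N)) (t : ZMod N) :
    aeval (ZMod.stdAddChar t : ℂ) (setMask A) = fourierSum A t := by
  classical
  have h : ∀ a : ZMod N, (ZMod.stdAddChar (t * a) : ℂ) = ZMod.stdAddChar t ^ a.val := fun a => by
    rw [← AddChar.map_nsmul_eq_pow, nsmul_eq_mul, ZMod.natCast_zmod_val, mul_comm]
  simp only [setMask, maskPolynomial, fourierSum, map_sum, map_mul, aeval_C, map_pow, aeval_X, h]
  simp [apply_ite, Finset.sum_ite_mem]

theorem orderOf_stdAddChar (t : ZMod N) :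
    orderOf (ZMod.stdAddChar t : ℂ) = N / N.gcd t.val := by
  have h := Complex.isPrimitiveRoot_exp N (NeZero.ne N)
  have hfin : IsOfFinOrder (Complex.exp (2 * Real.pi * Complex.I / N)) :=
    h.isOfFinOrder (NeZero.ne N)
  rw [stdAddChar_eq_pow, hfin.orderOf_pow, ← h.eq_orderOf]

theorem dvd_val_iff_cast_eq_zero {l : ℕ} (t : ZMod N) : l ∣ t.val ↔ (t.cast : ZMod l) = 0 := by
  rw [← ZMod.natCast_eq_zero_iff, ZMod.natCast_val]

theorem primeFactors_gcd_val (t : ZMod N) :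
    (N.gcd t.val).primeFactors = N.primeFactors \ primeSupport t := by
  ext l
  have := NeZero.ne N
  simp only [primeSupport, Nat.mem_primeFactors, Finset.mem_sdiff, Finset.mem_filter,
    Nat.dvd_gcd_iff, dvd_val_iff_cast_eq_zero, ne_eq, Nat.gcd_eq_zero_iff]
  tauto

theorem gcd_val_eq_prod (hN : Squarefree N) (t : ZMod N) :
    N.gcd t.val = ∏ l ∈ N.primeFactors \ primeSupport t, l := by
  rw [← primeFactors_gcd_val,
    Nat.prod_primeFactors_of_squarefree (hN.squarefree_of_dvd (Nat.gcd_dvd_left _ _))]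

theorem eq_zero_of_primeSupport_eq_empty (hN : Squarefree N) {t : ZMod N}
    (h : primeSupport t = ∅) : t = 0 := by
  have h1 := gcd_val_eq_prod hN t
  rw [h, Finset.sdiff_empty, Nat.prod_primeFactors_of_squarefree hN] at h1
  rw [← ZMod.natCast_zmod_val t, ZMod.natCast_eq_zero_iff]
  exact Nat.gcd_eq_left_iff_dvd.1 h1

theorem fourierSum_eq_zero_iff_cyclotomic_dvd (A : Finset (ZMod N)) (t : ZMod N) :
    fourierSum A t = 0 ↔ cyclotomic (N / N.gcd t.val) ℚ ∣ setMask A := by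
  have hpos : 0 < N / N.gcd t.val := Nat.div_pos
    (Nat.le_of_dvd (NeZero.pos N) (Nat.gcd_dvd_left _ _)) (Nat.gcd_pos_of_pos_left _ (NeZero.pos N))
  have hz : IsPrimitiveRoot (ZMod.stdAddChar t : ℂ) (N / N.gcd t.val) := by
    rw [← orderOf_stdAddChar]
    exact IsPrimitiveRoot.orderOf _
  rw [cyclotomic_eq_minpoly_rat hz hpos, minpoly.dvd_iff, aeval_setMask]

/-- A frequency with all prime coordinates nonzero is a unit, so it corresponds to a primitive
`N`-th root of unity. -/
theorem fourierSum_ne_zero_of_not_dvd (hN : Squarefree N) {A : Finset (ZMod N)}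
    (h : ¬ cyclotomic N ℚ ∣ setMask A) {t : ZMod N} (ht : primeSupport t = N.primeFactors) :
    fourierSum A t ≠ 0 := by
  rwa [Ne, fourierSum_eq_zero_iff_cyclotomic_dvd, gcd_val_eq_prod hN, ht, Finset.sdiff_self,
    Finset.prod_empty, Nat.div_one]

/-- Galois invariance: for squarefree `N`, frequencies with the same prime support have the same
order, so the corresponding roots of unity are conjugate over `ℚ`. -/
theorem vanishesOn_of_fourierSum_eq_zero (hN : Squarefree N) {A : Finset (ZMod N)} {t : ZMod N}
    (h : fourierSum A t = 0) :
    VanishesOn (fun x => if x ∈ A then 1 else 0) (primeSupport t) := by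
  intro t' ht'
  have : fourierSum A t' = 0 := by
    rw [fourierSum_eq_zero_iff_cyclotomic_dvd, gcd_val_eq_prod hN, ht', ← gcd_val_eq_prod hN,
      ← fourierSum_eq_zero_iff_cyclotomic_dvd]
    exact h
  simpa [fourierSum, Finset.sum_ite_mem] using this

theorem stdAddChar_div_mul {l : ℕ} [NeZero l] (hl : l ∣ N) (j : ZMod l) (x : ZMod N) :
    (ZMod.stdAddChar (((N / l * j.val : ℕ) : ZMod N) * x) : ℂ) =
      ZMod.stdAddChar (j * (x.cast : ZMod l)) := by
  have h1 : ((N / l * j.val : ℕ) : ZMod N) * x = ((N / l * j.val * x.val : ℕ) : ℤ) := by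
    rw [Int.cast_natCast, Nat.cast_mul _ x.val, ZMod.natCast_zmod_val]
  have h2 : j * (x.cast : ZMod l) = ((j.val * x.val : ℕ) : ℤ) := by simp
  rw [h1, h2, ZMod.stdAddChar_coe, ZMod.stdAddChar_coe]
  congr 1
  obtain ⟨m, rfl⟩ := hl
  have hl0 : l ≠ 0 := NeZero.ne l
  have hm0 : m ≠ 0 := by rintro rfl; exact NeZero.ne (l * 0) (mul_zero l)
  rw [Nat.mul_div_cancel_left _ (NeZero.pos l)]
  push_cast
  field_simp

/-- Adding a nonzero multiple of `N / l` to a frequency changes its coordinate mod `l` and no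
other. -/
theorem primeSupport_add (hN : Squarefree N) {l : ℕ} (hlp : l.Prime) (hl : l ∣ N) {t : ZMod N}
    (ht : l ∉ primeSupport t) {j : ZMod l} (hj : j ≠ 0) :
    primeSupport (t + ((N / l * j.val : ℕ) : ZMod N)) = insert l (primeSupport t) := by
  have := Fact.mk hlp
  have hlN : l ∈ N.primeFactors := Nat.mem_primeFactors.2 ⟨hlp, hl, NeZero.ne N⟩
  ext l'
  by_cases h' : l' ∈ N.primeFactors
  swap
  · have : l' ≠ l := by rintro rfl; exact h' hlN
    simp [primeSupport, -Nat.mem_primeFactors, h', this]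
  have hd : l' ∣ N := Nat.dvd_of_mem_primeFactors h'
  have hp' := Nat.prime_of_mem_primeFactors h'
  have hx : ((t + ((N / l * j.val : ℕ) : ZMod N)).cast : ZMod l') =
      t.cast + ((N / l * j.val : ℕ) : ZMod l') := by
    rw [ZMod.cast_add hd, ZMod.cast_natCast hd]
  simp only [primeSupport, Finset.mem_filter, Finset.mem_insert, h', true_and, hx]
  by_cases hll : l' = l
  · subst hll
    have ht0 : (t.cast : ZMod l') = 0 := by
      by_contra h
      exact ht (Finset.mem_filter.2 ⟨h', h⟩)
    have h2 : ((N / l' : ℕ) : ZMod l') ≠ 0 := by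
      rw [Ne, ZMod.natCast_eq_zero_iff]
      intro hdiv
      have : l' * l' ∣ N := by
        have := mul_dvd_mul_left l' hdiv
        rwa [Nat.mul_div_cancel' hd] at this
      exact hp'.one_lt.ne' (Nat.isUnit_iff.1 (hN l' this))
    simp [ht0, h2, hj]
  · have : l' ∣ N / l := by
      have h3 : l' ∣ l * (N / l) := by rwa [Nat.mul_div_cancel' hl]
      refine ((Nat.coprime_primes hp' hlp).2 hll).dvd_of_dvd_mul_left h3
    have h4 : ((N / l : ℕ) : ZMod l') = 0 := (ZMod.natCast_eq_zero_iff _ _).2 this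
    simp [h4, hll]

/-- Weighting `g` by the difference of the indicators of two residue classes mod `l` removes `l`
from the set of nonzero coordinates on which the Fourier transform vanishes. Indeed such a
difference is a combination of the nontrivial characters mod `l`, and multiplication by one of
them shifts the frequency by a nonzero multiple of `N / l`. -/
theorem VanishesOn.sub_indicator (hN : Squarefree N) {g : ZMod N → ℂ} {P : Finset ℕ}
    {l : ℕ} (hlp : l.Prime) (hl : l ∣ N) (hlP : l ∉ P) (hg : VanishesOn g (insert l P))
    (a b : ZMod l) :
    VanishesOn (fun x => g x * ((if (x.cast : ZMod l) = a then 1 else 0) -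
      (if (x.cast : ZMod l) = b then 1 else 0))) P := by
  have := Fact.mk hlp
  have : NeZero l := ⟨hlp.ne_zero⟩
  rintro t rfl
  have hl0 : (l : ℂ) ≠ 0 := by exact_mod_cast hlp.ne_zero
  -- expand the indicator of a residue class in characters mod `l`
  have hind : ∀ y a : ZMod l, (l : ℂ) * (if y = a then 1 else 0) =
      ∑ j : ZMod l, ZMod.stdAddChar (j * y) * ZMod.stdAddChar (-(j * a)) := by
    intro y a
    have := AddChar.sum_mulShift (y - a) (ZMod.isPrimitive_stdAddChar l)
    simp only [sub_eq_zero, ZMod.card] at this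
    rw [mul_ite, mul_one, mul_zero]
    push_cast at this
    rw [← this]
    refine Finset.sum_congr rfl fun j _ => ?_
    rw [← AddChar.map_add_eq_mul]
    congr 1
    ring
  rw [← mul_right_inj' hl0, mul_zero]
  have hexp : ∀ x : ZMod N, (l : ℂ) * (g x * ((if (x.cast : ZMod l) = a then 1 else 0) -
      (if (x.cast : ZMod l) = b then 1 else 0)) * ZMod.stdAddChar (t * x)) =
      ∑ j : ZMod l, (ZMod.stdAddChar (-(j * a)) - ZMod.stdAddChar (-(j * b))) *
        (g x * ZMod.stdAddChar ((t + ((N / l * j.val : ℕ) : ZMod N)) * x)) := by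
    intro x
    have e1 := hind x.cast a
    have e2 := hind x.cast b
    have : ∀ j : ZMod l, (ZMod.stdAddChar (-(j * a)) - ZMod.stdAddChar (-(j * b))) *
        (g x * ZMod.stdAddChar ((t + ((N / l * j.val : ℕ) : ZMod N)) * x)) =
        g x * ZMod.stdAddChar (t * x) *
          (ZMod.stdAddChar (j * (x.cast : ZMod l)) * ZMod.stdAddChar (-(j * a))) -
        g x * ZMod.stdAddChar (t * x) *
          (ZMod.stdAddChar (j * (x.cast : ZMod l)) * ZMod.stdAddChar (-(j * b))) := fun j => by
      rw [add_mul, AddChar.map_add_eq_mul, stdAddChar_div_mul hl]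
      ring
    rw [Finset.sum_congr rfl fun j _ => this j, Finset.sum_sub_distrib, ← Finset.mul_sum,
      ← Finset.mul_sum, ← e1, ← e2]
    ring
  rw [Finset.mul_sum, Finset.sum_congr rfl fun x _ => hexp x, Finset.sum_comm]
  refine Finset.sum_eq_zero fun j _ => ?_
  rw [← Finset.mul_sum]
  -- the trivial character cancels in the difference of the two indicators
  by_cases hj : j = 0
  · simp [hj]
  · rw [hg _ (primeSupport_add hN hlp hl hlP hj), mul_zero]

theorem VanishesOn.sum_eq_zero {g : ZMod N → ℂ} (hg : VanishesOn g ∅) : ∑ x, g x = 0 := by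
  have := hg 0 (by
    rw [primeSupport, Finset.filter_eq_empty_iff]
    intro l hl
    simp)
  simpa using this

theorem cast_eq_cast_iff_dvd {k : ℕ} (hk : k ∣ N) (x y : ZMod N) :
    (x.cast : ZMod k) = y.cast ↔ k ∣ (x - y).val := by
  rw [dvd_val_iff_cast_eq_zero, ZMod.cast_sub hk, sub_eq_zero]

/-! ### Alternating sums of multiplicities -/

/-- The case of one prime: `A` is equidistributed mod `l`. -/
theorem card_filter_eq_of_fourierSum_eq_zero (hN : Squarefree N) {A : Finset (ZMod N)}
    {t : ZMod N} (h : fourierSum A t = 0) {l : ℕ} (hlp : l.Prime) (hl : l ∣ N)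
    (ht : primeSupport t = {l}) (a b : ZMod l) :
    (A.filter fun x => (x.cast : ZMod l) = a).card =
      (A.filter fun x => (x.cast : ZMod l) = b).card := by
  have h1 := vanishesOn_of_fourierSum_eq_zero hN h
  rw [ht, ← insert_empty_eq] at h1
  have h2 := (h1.sub_indicator hN hlp hl (by simp) a b).sum_eq_zero
  simp only [ite_mul, one_mul, zero_mul, Finset.sum_ite_mem, Finset.univ_inter,
    Finset.sum_sub_distrib, Finset.sum_boole, sub_eq_zero] at h2
  exact_mod_cast h2

theorem dvd_card_of_fourierSum_eq_zero (hN : Squarefree N) {A : Finset (ZMod N)}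
    {t : ZMod N} (h : fourierSum A t = 0) {l : ℕ} (hlp : l.Prime) (hl : l ∣ N)
    (ht : primeSupport t = {l}) : l ∣ A.card := by
  have : NeZero l := ⟨hlp.ne_zero⟩
  rw [Finset.card_eq_sum_card_fiberwise (f := fun x => (x.cast : ZMod l)) (t := Finset.univ)
    (fun _ _ => Finset.mem_univ _), Finset.sum_congr rfl fun b _ =>
    card_filter_eq_of_fourierSum_eq_zero hN h hlp hl ht b 0]
  simp

/-- The case of two primes: the number of elements of `A` over a point of `ℤ/l × ℤ/m` is the sum
of a function of the first coordinate and a function of the second one. -/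
theorem card_filter_add_of_fourierSum_eq_zero (hN : Squarefree N) {A : Finset (ZMod N)}
    {t : ZMod N} (h : fourierSum A t = 0) {l m : ℕ} (hlp : l.Prime) (hl : l ∣ N)
    (hmp : m.Prime) (hm : m ∣ N) (hlm : l ≠ m) (ht : primeSupport t = {l, m})
    (x x' : ZMod l) (y y' : ZMod m) :
    (A.filter fun z => (z.cast : ZMod l) = x ∧ (z.cast : ZMod m) = y).card +
        (A.filter fun z => (z.cast : ZMod l) = x' ∧ (z.cast : ZMod m) = y').card =
      (A.filter fun z => (z.cast : ZMod l) = x ∧ (z.cast : ZMod m) = y').card +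
        (A.filter fun z => (z.cast : ZMod l) = x' ∧ (z.cast : ZMod m) = y).card := by
  have h1 := vanishesOn_of_fourierSum_eq_zero hN h
  rw [ht, ← insert_empty_eq m] at h1
  have h2 := ((h1.sub_indicator hN hlp hl (by simpa using hlm) x x').sub_indicator hN hmp hm
    (by simp) y y').sum_eq_zero
  simp only [ite_mul, one_mul, zero_mul, Finset.sum_ite_mem, Finset.univ_inter] at h2
  rw [← Nat.cast_inj (R := ℂ)]
  push_cast [Finset.card_filter]
  rw [← Finset.sum_add_distrib, ← Finset.sum_add_distrib, ← sub_eq_zero,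
    ← Finset.sum_sub_distrib]
  refine Eq.trans (Finset.sum_congr rfl fun z _ => ?_) h2
  simp only [ite_and, sub_mul, mul_sub, ite_mul, one_mul, zero_mul]
  ring

/-- The case of three primes: the alternating sum of the multiplicities of `A` over the vertices
of a box in `ℤ/l × ℤ/m × ℤ/n` is zero. -/
theorem sum_cube_of_fourierSum_eq_zero (hN : Squarefree N) {A : Finset (ZMod N)}
    {t : ZMod N} (h : fourierSum A t = 0) {l m n : ℕ} (hlp : l.Prime) (hl : l ∣ N)
    (hmp : m.Prime) (hm : m ∣ N) (hnp : n.Prime) (hn : n ∣ N) (hlm : l ≠ m) (hln : l ≠ n)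
    (hmn : m ≠ n) (ht : primeSupport t = {l, m, n})
    (x x' : ZMod l) (y y' : ZMod m) (z z' : ZMod n) :
    ∑ g ∈ A, (((if (g.cast : ZMod l) = x then 1 else 0) - (if (g.cast : ZMod l) = x' then 1 else 0))
      * ((if (g.cast : ZMod m) = y then 1 else 0) - (if (g.cast : ZMod m) = y' then 1 else 0))
      * ((if (g.cast : ZMod n) = z then 1 else 0) - (if (g.cast : ZMod n) = z' then 1 else 0)) : ℤ)
      = 0 := by
  have h1 := vanishesOn_of_fourierSum_eq_zero hN h
  rw [ht, ← insert_empty_eq n] at h1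
  have h2 := (((h1.sub_indicator hN hlp hl (by simp [hlm, hln]) x x').sub_indicator hN hmp hm
    (by simp [hmn]) y y').sub_indicator hN hnp hn (by simp) z z').sum_eq_zero
  simp only [ite_mul, one_mul, zero_mul, Finset.sum_ite_mem, Finset.univ_inter] at h2
  exact_mod_cast h2

end Fourier

/-! ### Sets of grid points sharing coordinates -/

section Grid

variable {ι α β : Type*} {a : ι → α} {b : ι → β}

/-- If every element of `B` shares a coordinate with every element of `C` and two elements of `B`
lie on a line `a = const`, then `C` lies on the same line. -/
theorem forall_eq_of_cross {B C : Finset ι}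
    (hinj : ∀ i ∈ B, ∀ j ∈ B, a i = a j → b i = b j → i = j)
    (hBC : ∀ i ∈ B, ∀ j ∈ C, a i = a j ∨ b i = b j) {i j : ι} (hi : i ∈ B) (hj : j ∈ B)
    (hij : i ≠ j) (hline : a i = a j) : ∀ k ∈ C, a i = a k := by
  intro k hk
  by_contra hne
  have h1 := (hBC i hi k hk).resolve_left hne
  have h2 := (hBC j hj k hk).resolve_left (hline ▸ hne)
  exact hij (hinj i hi j hj hline (h1.trans h2.symm))

/-- If every element of `B` shares a coordinate with every element of `C` and two elements of `B`
differ in both coordinates, then `C` is contained in the two remaining corners of their rectangle. -/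
theorem card_le_two_of_cross {B C : Finset ι}
    (hinj : ∀ i ∈ C, ∀ j ∈ C, a i = a j → b i = b j → i = j)
    (hBC : ∀ i ∈ B, ∀ j ∈ C, a i = a j ∨ b i = b j) {i j : ι} (hi : i ∈ B) (hj : j ∈ B)
    (ha : a i ≠ a j) (hb : b i ≠ b j) :
    C.card ≤ 2 ∧ ∀ k ∈ C, ∀ l ∈ C, k ≠ l → a k ≠ a l ∧ b k ≠ b l := by
  classical
  have h : ∀ k ∈ C, (a k = a i ∧ b k = b j) ∨ (a k = a j ∧ b k = b i) := fun k hk => by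
    have := hBC i hi k hk
    have := hBC j hj k hk
    grind
  constructor
  · have : (C.image a).card ≤ ({a i, a j} : Finset α).card := by
      refine Finset.card_le_card fun x hx => ?_
      obtain ⟨k, hk, rfl⟩ := Finset.mem_image.1 hx
      rcases h k hk with h | h <;> simp [h.1]
    rw [Finset.card_image_of_injOn] at this
    · exact this.trans Finset.card_le_two
    · intro k hk l hl hkl
      have := h k hk
      have := h l hl
      have := hinj k hk l hl hkl
      grind
  · intro k hk l hl hkl
    have := h k hk
    have := h l hl
    have := hinj k hk l hl
    grind

/-- Two sets of grid points such that every point of one shares a coordinate with every point of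
the other lie on a common line, unless one is a singleton or they are the two diagonals of a
rectangle. -/
theorem collinear_of_cross {B C : Finset ι}
    (hB : ∀ i ∈ B, ∀ j ∈ B, a i = a j → b i = b j → i = j)
    (hC : ∀ i ∈ C, ∀ j ∈ C, a i = a j → b i = b j → i = j)
    (hBC : ∀ i ∈ B, ∀ j ∈ C, a i = a j ∨ b i = b j)
    (h2B : 2 ≤ B.card) (h2C : 2 ≤ C.card) (h5 : 5 ≤ B.card + C.card) :
    (∃ x, (∀ i ∈ B, a i = x) ∧ ∀ i ∈ C, a i = x) ∨
      ∃ y, (∀ i ∈ B, b i = y) ∧ ∀ i ∈ C, b i = y := by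
  obtain ⟨i, hi, j, hj, hij⟩ := Finset.one_lt_card.1 h2B
  obtain ⟨k, hk, l, hl, hkl⟩ := Finset.one_lt_card.1 h2C
  have hCB : ∀ i ∈ C, ∀ j ∈ B, a i = a j ∨ b i = b j := fun i hi j hj =>
    (hBC j hj i hi).imp Eq.symm Eq.symm
  by_cases ha : a i = a j
  · have h1 := forall_eq_of_cross hB hBC hi hj hij ha
    have h2 := forall_eq_of_cross hC hCB hk hl hkl ((h1 k hk).symm.trans (h1 l hl))
    exact .inl ⟨a k, fun m hm => (h2 m hm).symm, fun m hm => (h1 m hm).symm.trans (h1 k hk)⟩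
  by_cases hb : b i = b j
  · have h1 := forall_eq_of_cross (a := b) (b := a) (fun i hi j hj h h' => hB i hi j hj h' h)
      (fun i hi j hj => (hBC i hi j hj).symm) hi hj hij hb
    have h2 := forall_eq_of_cross (a := b) (b := a) (fun i hi j hj h h' => hC i hi j hj h' h)
      (fun i hi j hj => (hCB i hi j hj).symm) hk hl hkl ((h1 k hk).symm.trans (h1 l hl))
    exact .inr ⟨b k, fun m hm => (h2 m hm).symm, fun m hm => (h1 m hm).symm.trans (h1 k hk)⟩
  · have h1 := card_le_two_of_cross hC hBC hi hj ha hb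
    have h2 := h1.2 k hk l hl hkl
    have h3 := (card_le_two_of_cross hB hCB hk hl h2.1 h2.2).1
    omega

theorem card_le_of_forall_eq [Fintype β] {M : Finset ι}
    (hM : ∀ i ∈ M, ∀ j ∈ M, a i = a j → b i = b j → i = j) {x : α} (h : ∀ i ∈ M, a i = x) :
    M.card ≤ Fintype.card β := by
  classical
  rw [← Finset.card_univ]
  exact Finset.card_le_card_of_injOn b (fun _ _ => Finset.mem_univ _)
    fun i hi j hj hij => hM i hi j hj ((h i hi).trans (h j hj).symm) hij

theorem card_lt_of_subset_cross [Fintype α] [Fintype β] {M : Finset ι}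
    (hM : ∀ i ∈ M, ∀ j ∈ M, a i = a j → b i = b j → i = j) {x : α} {y : β}
    (h : ∀ i ∈ M, a i = x ∨ b i = y) : M.card < Fintype.card α + Fintype.card β := by
  classical
  have h1 : (M.filter fun i => a i = x).card ≤ Fintype.card β :=
    card_le_of_forall_eq (a := a) (b := b) (x := x)
      (fun i hi j hj => hM i (Finset.mem_filter.1 hi).1 j (Finset.mem_filter.1 hj).1)
      (fun i hi => (Finset.mem_filter.1 hi).2)
  have h2 : (M.filter fun i => ¬ a i = x).card ≤ (Finset.univ.erase x).card := by
    refine Finset.card_le_card_of_injOn a ?_ ?_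
    · intro i hi
      simpa using (Finset.mem_filter.1 hi).2
    · intro i hi j hj hij
      obtain ⟨hi, hi'⟩ := Finset.mem_filter.1 hi
      obtain ⟨hj, hj'⟩ := Finset.mem_filter.1 hj
      exact hM i hi j hj hij (((h i hi).resolve_left hi').trans ((h j hj).resolve_left hj').symm)
  rw [Finset.card_erase_of_mem (Finset.mem_univ _), Finset.card_univ] at h2
  have h3 := Finset.card_filter_add_card_filter_not (s := M) fun i => a i = x
  have : 0 < Fintype.card α := Fintype.card_pos_iff.2 ⟨x⟩
  omega

theorem card_add_card_lt_of_cross [Fintype α] [Fintype β] {B C : Finset ι} (hd : Disjoint B C)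
    (hinj : ∀ i, i ∈ B ∨ i ∈ C → ∀ j, j ∈ B ∨ j ∈ C → a i = a j → b i = b j → i = j)
    (hBC : ∀ i ∈ B, ∀ j ∈ C, a i = a j ∨ b i = b j) (hB : B.Nonempty) (hC : C.Nonempty)
    (hα : 1 ≤ Fintype.card α) (hβ : 1 ≤ Fintype.card β)
    (h5 : 5 ≤ Fintype.card α + Fintype.card β) :
    B.card + C.card < Fintype.card α + Fintype.card β := by
  classical
  have hU : ∀ i ∈ B ∪ C, ∀ j ∈ B ∪ C, a i = a j → b i = b j → i = j := by
    simpa only [Finset.mem_union] using hinj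
  rw [← Finset.card_union_of_disjoint hd]
  have hB1 := hB.card_pos
  have hC1 := hC.card_pos
  by_cases h1 : B.card = 1
  · obtain ⟨i, rfl⟩ := Finset.card_eq_one.1 h1
    refine card_lt_of_subset_cross (x := a i) (y := b i) hU fun j hj => ?_
    rcases Finset.mem_union.1 hj with hj | hj
    · exact .inl (by rw [Finset.mem_singleton.1 hj])
    · exact (hBC i (by simp) j hj).imp Eq.symm Eq.symm
  by_cases h2 : C.card = 1
  · obtain ⟨i, rfl⟩ := Finset.card_eq_one.1 h2
    refine card_lt_of_subset_cross (x := a i) (y := b i) hU fun j hj => ?_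
    rcases Finset.mem_union.1 hj with hj | hj
    · exact hBC j hj i (by simp)
    · exact .inl (by rw [Finset.mem_singleton.1 hj])
  by_cases h4 : B.card + C.card < 5
  · rw [Finset.card_union_of_disjoint hd]
    omega
  rcases collinear_of_cross (fun i hi j hj => hinj i (.inl hi) j (.inl hj))
    (fun i hi j hj => hinj i (.inr hi) j (.inr hj)) hBC (by omega) (by omega) (by omega) with
    ⟨x, h, h'⟩ | ⟨x, h, h'⟩
  · have := card_le_of_forall_eq hU (x := x) (by
      intro i hi; exact (Finset.mem_union.1 hi).elim (h i) (h' i))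
    omega
  · have := card_le_of_forall_eq (a := b) (b := a) (fun i hi j hj h h' => hU i hi j hj h' h)
      (x := x) (by intro i hi; exact (Finset.mem_union.1 hi).elim (h i) (h' i))
    omega

end Grid

section Additive

variable {γ δ : Type*} [Fintype γ] [Fintype δ]

/-- An additive weight is `w x y = u x + v y` with `u, v ≥ 0` (normalize at a minimum of `w`). If
its total mass is divisible by neither side of the grid, then `u` and `v` are both nonzero, which
gives a row and a column on which `w` is positive, and which meet in a point of weight at least
`2`. -/
theorem exists_row_col_of_additive {w : γ → δ → ℕ}
    (hadd : ∀ x x' y y', w x y + w x' y' = w x y' + w x' y)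
    (hγ : ¬ Fintype.card γ ∣ ∑ x, ∑ y, w x y) (hδ : ¬ Fintype.card δ ∣ ∑ x, ∑ y, w x y) :
    ∃ x₀ y₀ u v, 1 ≤ u ∧ 1 ≤ v ∧ w x₀ y₀ = u + v ∧ (∀ y, u ≤ w x₀ y) ∧ ∀ x, v ≤ w x y₀ := by
  have hne : Nonempty (γ × δ) := by
    by_contra h
    rw [not_nonempty_iff, isEmpty_prod] at h
    rcases h with h | h <;> simp at hγ
  obtain ⟨⟨x₁, y₁⟩, hmin⟩ := Finite.exists_min fun z : γ × δ => w z.1 z.2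
  have hle : ∀ y, w x₁ y₁ ≤ w x₁ y := fun y => hmin (x₁, y)
  have hw : ∀ x y, w x y = w x y₁ + (w x₁ y - w x₁ y₁) := fun x y => by
    have := hadd x x₁ y y₁
    have := hle y
    omega
  have hsum : ∑ x, ∑ y, w x y = Fintype.card δ * (∑ x, w x y₁) +
      Fintype.card γ * ∑ y, (w x₁ y - w x₁ y₁) := by
    rw [Finset.sum_congr rfl fun x _ => Finset.sum_congr rfl fun y _ => hw x y]
    simp [Finset.sum_add_distrib, Finset.mul_sum]
  obtain ⟨x₀, hx₀⟩ : ∃ x₀, w x₀ y₁ ≠ 0 := by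
    by_contra! h
    exact hγ (by simp [hsum, h])
  obtain ⟨y₀, hy₀⟩ : ∃ y₀, w x₁ y₀ - w x₁ y₁ ≠ 0 := by
    by_contra! h
    exact hδ (by simp [hsum, h])
  refine ⟨x₀, y₀, w x₀ y₁, w x₁ y₀ - w x₁ y₁, by omega, by omega, hw _ _, fun y => ?_, fun x => ?_⟩
  · rw [hw x₀ y]; omega
  · rw [hw x y₀]; omega

end Additive

section FourCoordinates

variable {ι α β γ δ : Type*} [DecidableEq γ] [DecidableEq δ] [Fintype γ] [Fintype δ]

theorem mul_le_card_filter_ne {M : Finset ι} (d : ι → δ) (y₀ : δ) {u : ℕ}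
    (h : ∀ y, u ≤ (M.filter fun i => d i = y).card) :
    (Fintype.card δ - 1) * u ≤ (M.filter fun i => d i ≠ y₀).card := by
  have hcard := Finset.card_eq_sum_card_fiberwise (s := M.filter fun i => d i ≠ y₀) (f := d)
    (t := Finset.univ.erase y₀) (fun i hi => by simpa using (Finset.mem_filter.1 hi).2)
  rw [hcard, ← Finset.card_univ, ← Finset.card_erase_of_mem (Finset.mem_univ y₀), ← smul_eq_mul]
  refine Finset.card_nsmul_le_sum _ _ _ fun y hy => (h y).trans (Finset.card_le_card fun i hi => ?_)
  obtain ⟨h1, rfl⟩ := Finset.mem_filter.1 hi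
  simp [h1, Finset.ne_of_mem_erase hy]

/-- A set `L` which is mapped injectively to the grid `α × β`, any two elements of which agree in
one of the four coordinates, and which charges every point of a row and of a column of `γ × δ`,
does not fill the grid `α × β`. The row `x₀` and the column `y₀` cut `L` into four blocks;
opposite blocks differ in both `c` and `d`, so in `α × β` their elements pairwise share a
coordinate. Hence a pair of opposite blocks is small, roughly the size of one line of `α × β`,
which is too small for `L`. -/
theorem card_ne_mul_of_agree [Fintype α] [Fintype β] {L : Finset ι} {a : ι → α} {b : ι → β}
    {c : ι → γ} {d : ι → δ}
    (hinj : ∀ i ∈ L, ∀ j ∈ L, a i = a j → b i = b j → i = j)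
    (hagree : ∀ i ∈ L, ∀ j ∈ L, a i = a j ∨ b i = b j ∨ c i = c j ∨ d i = d j)
    {x₀ : γ} {y₀ : δ} {u v : ℕ} (hu : 1 ≤ u) (hv : 1 ≤ v)
    (hw : (L.filter fun i => c i = x₀ ∧ d i = y₀).card = u + v)
    (hrow : ∀ y, u ≤ (L.filter fun i => c i = x₀ ∧ d i = y).card)
    (hcol : ∀ x, v ≤ (L.filter fun i => c i = x ∧ d i = y₀).card)
    (hα : 2 ≤ Fintype.card α) (hβ : 2 ≤ Fintype.card β)
    (hγ : 2 ≤ Fintype.card γ) (hδ : 2 ≤ Fintype.card δ) (hγδ : Fintype.card γ ≠ Fintype.card δ)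
    (h3 : (3 ≤ Fintype.card α ∧ 3 ≤ Fintype.card β ∧ 8 ≤ Fintype.card α + Fintype.card β) ∨
      (3 ≤ Fintype.card γ ∧ 3 ≤ Fintype.card δ)) :
    L.card ≠ Fintype.card α * Fintype.card β := by
  classical
  intro hL
  -- `B` is opposite to `C`, and `B'` to `C'`
  let B := L.filter fun i => c i = x₀ ∧ d i = y₀
  let C := L.filter fun i => c i ≠ x₀ ∧ d i ≠ y₀
  let B' := L.filter fun i => c i = x₀ ∧ d i ≠ y₀
  let C' := L.filter fun i => c i ≠ x₀ ∧ d i = y₀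
  have hB : ∀ i, i ∈ B ↔ i ∈ L ∧ c i = x₀ ∧ d i = y₀ := fun i => Finset.mem_filter
  have hC : ∀ i, i ∈ C ↔ i ∈ L ∧ c i ≠ x₀ ∧ d i ≠ y₀ := fun i => Finset.mem_filter
  have hB' : ∀ i, i ∈ B' ↔ i ∈ L ∧ c i = x₀ ∧ d i ≠ y₀ := fun i => Finset.mem_filter
  have hC' : ∀ i, i ∈ C' ↔ i ∈ L ∧ c i ≠ x₀ ∧ d i = y₀ := fun i => Finset.mem_filter
  have hBcard : B.card = u + v := hw
  have hB'card : (Fintype.card δ - 1) * u ≤ B'.card := by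
    have := mul_le_card_filter_ne (M := L.filter fun i => c i = x₀) d y₀
      (by simpa only [Finset.filter_filter] using hrow)
    simpa only [Finset.filter_filter] using this
  have hC'card : (Fintype.card γ - 1) * v ≤ C'.card := by
    have := mul_le_card_filter_ne (M := L.filter fun i => d i = y₀) c x₀
      (by simpa only [Finset.filter_filter, and_comm] using hcol)
    simpa only [Finset.filter_filter, and_comm, C'] using this
  have htotal : L.card = B.card + C.card + (B'.card + C'.card) := by
    have e1 := Finset.card_filter_add_card_filter_not (s := L) fun i => c i = x₀
    have e2 := Finset.card_filter_add_card_filter_not (s := L.filter fun i => c i = x₀)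
      fun i => d i = y₀
    have e3 := Finset.card_filter_add_card_filter_not (s := L.filter fun i => ¬ c i = x₀)
      fun i => d i = y₀
    simp only [Finset.filter_filter] at e2 e3
    simp only [B, C, B', C', Ne]
    omega
  have hcross' : ∀ i ∈ B', ∀ j ∈ C', a i = a j ∨ b i = b j := fun i hi j hj => by
    rw [hB'] at hi
    rw [hC'] at hj
    have := hagree i hi.1 j hj.1
    grind
  have hcross : ∀ i ∈ B, ∀ j ∈ C, a i = a j ∨ b i = b j := fun i hi j hj => by
    rw [hB] at hi
    rw [hC] at hj
    have := hagree i hi.1 j hj.1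
    grind
  have hBL : ∀ i ∈ B, i ∈ L := fun i hi => ((hB i).1 hi).1
  have hCL : ∀ i ∈ C, i ∈ L := fun i hi => ((hC i).1 hi).1
  have hB'L : ∀ i ∈ B', i ∈ L := fun i hi => ((hB' i).1 hi).1
  have hC'L : ∀ i ∈ C', i ∈ L := fun i hi => ((hC' i).1 hi).1
  rcases h3 with ⟨hα3, hβ3, h8⟩ | ⟨hγ3, hδ3⟩
  -- each pair of opposite blocks has less than `|α| + |β|` elements
  · have hB'pos : u ≤ B'.card := le_trans (Nat.le_mul_of_pos_left _ (by omega)) hB'card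
    have hC'pos : v ≤ C'.card := le_trans (Nat.le_mul_of_pos_left _ (by omega)) hC'card
    have e1 : B'.card + C'.card < Fintype.card α + Fintype.card β :=
      card_add_card_lt_of_cross (Finset.disjoint_left.2 fun i hi hi' => by
          rw [hB'] at hi; rw [hC'] at hi'; tauto)
        (fun i hi j hj => hinj i (hi.elim (hB'L i) (hC'L i)) j (hj.elim (hB'L j) (hC'L j)))
        hcross' (Finset.card_pos.1 (by omega)) (Finset.card_pos.1 (by omega)) (by omega)
        (by omega) (by omega)
    have e2 : B.card + C.card < Fintype.card α + Fintype.card β := by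
      rcases C.eq_empty_or_nonempty with h0 | h0
      · rw [h0, Finset.card_empty]
        omega
      · exact card_add_card_lt_of_cross (Finset.disjoint_left.2 fun i hi hi' => by
            rw [hB] at hi; rw [hC] at hi'; tauto)
          (fun i hi j hj => hinj i (hi.elim (hBL i) (hCL i)) j (hj.elim (hBL j) (hCL j)))
          hcross (Finset.card_pos.1 (by omega)) h0 (by omega) (by omega) (by omega)
    obtain ⟨m, hm⟩ := Nat.exists_eq_add_of_le hα3
    obtain ⟨n, hn⟩ := Nat.exists_eq_add_of_le hβ3
    have h1 : L.card = 9 + 3 * m + 3 * n + m * n := by rw [hL, hm, hn]; ring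
    have := Nat.zero_le (m * n)
    omega
  -- `B'`, `C'` and `C` lie on one line, and `B` is at most half as large as `B' ∪ C'`
  · have hB'2 : 2 * u ≤ B'.card := le_trans (Nat.mul_le_mul_right _ (by omega)) hB'card
    have hC'2 : 2 * v ≤ C'.card := le_trans (Nat.mul_le_mul_right _ (by omega)) hC'card
    have h5 : 5 ≤ B'.card + C'.card := by
      have : 4 ≤ Fintype.card γ ∨ 4 ≤ Fintype.card δ := by omega
      rcases this with h | h
      · have : 3 * v ≤ C'.card := le_trans (Nat.mul_le_mul_right _ (by omega)) hC'card
        omega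
      · have : 3 * u ≤ B'.card := le_trans (Nat.mul_le_mul_right _ (by omega)) hB'card
        omega
    -- an element of `C` agrees in `a` or `b` with two different elements of `B' ∪ C'`
    have htwo : ∀ k ∈ C, ∃ i ∈ B', ∃ j ∈ C', (a k = a i ∨ b k = b i) ∧ (a k = a j ∨ b k = b j) := by
      intro k hk
      rw [hC] at hk
      obtain ⟨y, hy⟩ : ∃ y, y ∉ ({y₀, d k} : Finset δ) := by
        by_contra! h
        have := Finset.card_le_card fun y (_ : y ∈ Finset.univ) => h y
        rw [Finset.card_univ] at this
        have := Finset.card_le_two (a := y₀) (b := d k)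
        omega
      obtain ⟨x, hx⟩ : ∃ x, x ∉ ({x₀, c k} : Finset γ) := by
        by_contra! h
        have := Finset.card_le_card fun y (_ : y ∈ Finset.univ) => h y
        rw [Finset.card_univ] at this
        have := Finset.card_le_two (a := x₀) (b := c k)
        omega
      obtain ⟨i, hi⟩ := Finset.card_pos.1 (hu.trans (hrow y))
      obtain ⟨j, hj⟩ := Finset.card_pos.1 (hv.trans (hcol x))
      rw [Finset.mem_filter] at hi hj
      refine ⟨i, (hB' i).2 ?_, j, (hC' j).2 ?_, ?_⟩
      · grind
      · grind
      · have := hagree k hk.1 i hi.1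
        have := hagree k hk.1 j hj.1
        grind
    have hdisj : ∀ i ∈ B', ∀ j ∈ C', i ≠ j := by
      rintro i hi j hj rfl
      rw [hB'] at hi
      rw [hC'] at hj
      exact hj.2.1 hi.2.1
    have hunion : B'.card + C'.card + C.card = (B' ∪ C' ∪ C).card := by
      rw [Finset.card_union_of_disjoint, Finset.card_union_of_disjoint]
      · exact Finset.disjoint_left.2 fun i hi hi' => hdisj i hi i hi' rfl
      · refine Finset.disjoint_left.2 fun i hi hi' => ?_
        rw [Finset.mem_union, hB', hC'] at hi
        rw [hC] at hi'
        tauto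
    have hUL : ∀ i ∈ B' ∪ C' ∪ C, i ∈ L := fun i hi => by
      rw [Finset.mem_union, Finset.mem_union] at hi
      rcases hi with (hi | hi) | hi
      exacts [hB'L i hi, hC'L i hi, hCL i hi]
    have hbound : B'.card + C'.card + C.card ≤ max (Fintype.card α) (Fintype.card β) := by
      rw [hunion]
      rcases collinear_of_cross (fun i hi j hj => hinj i (hB'L i hi) j (hB'L j hj))
        (fun i hi j hj => hinj i (hC'L i hi) j (hC'L j hj)) hcross' (by omega) (by omega) h5 with
        ⟨x, h, h'⟩ | ⟨x, h, h'⟩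
      · refine le_max_of_le_right (card_le_of_forall_eq (x := x)
          (fun i hi j hj => hinj i (hUL i hi) j (hUL j hj)) fun k hk => ?_)
        rw [Finset.mem_union, Finset.mem_union] at hk
        rcases hk with (hk | hk) | hk
        · exact h k hk
        · exact h' k hk
        · obtain ⟨i, hi, j, hj, hki, hkj⟩ := htwo k hk
          have := hinj i (hB'L i hi) j (hC'L j hj)
          have := hdisj i hi j hj
          grind
      · refine le_max_of_le_left (card_le_of_forall_eq (a := b) (b := a) (x := x)
          (fun i hi j hj h h' => hinj i (hUL i hi) j (hUL j hj) h' h) fun k hk => ?_)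
        rw [Finset.mem_union, Finset.mem_union] at hk
        rcases hk with (hk | hk) | hk
        · exact h k hk
        · exact h' k hk
        · obtain ⟨i, hi, j, hj, hki, hkj⟩ := htwo k hk
          have := hinj i (hB'L i hi) j (hC'L j hj)
          have := hdisj i hi j hj
          grind
    have : L.card < 2 * max (Fintype.card α) (Fintype.card β) := by omega
    rw [hL] at this
    rcases le_total (Fintype.card α) (Fintype.card β) with h | h
    · rw [max_eq_right h] at this
      nlinarith
    · rw [max_eq_left h] at this
      nlinarith

end FourCoordinates

/-! ### Tilings and residue systems -/

section Tiling

variable {N : ℕ} [NeZero N]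

/-- In a tiling `A ⊕ T = ℤ/Nℤ` the set `T` may be dilated by a prime `l` not dividing `|T|`: in
the group algebra over `ℤ/l` the Frobenius map gives `A * T ^ l = |T| ^ (l - 1) * (∑ x) = ∑ x`, so
each element has a representation `a + l t`. -/
theorem covers_image_smul_prime {A T : Finset (ZMod N)} {l : ℕ} (hl : l.Prime)
    (hcard : A.card * T.card = N) (hlT : ¬ l ∣ T.card)
    (hcov : ∀ x : ZMod N, ∃ a ∈ A, ∃ t ∈ T, a + t = x) :
    ∀ x : ZMod N, ∃ a ∈ A, ∃ t ∈ T, a + l • t = x := by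
  classical
  have := Fact.mk hl
  obtain ⟨e, hedef⟩ : ∃ e : ZMod N → AddMonoidAlgebra (ZMod l) (ZMod N),
    e = fun x => AddMonoidAlgebra.single x 1 := ⟨_, rfl⟩
  have he : ∀ x y, e x * e y = e (x + y) := fun x y => by
    rw [hedef, AddMonoidAlgebra.single_mul_single, one_mul]
  obtain ⟨U, hUdef⟩ : ∃ U, U = ∑ x, e x := ⟨_, rfl⟩
  have hU : ∀ t, U * e t = U := fun t => by
    simp only [hUdef, Finset.sum_mul, he]
    exact Fintype.sum_equiv (Equiv.addRight t) _ e fun _ => rfl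
  -- covering together with `|A| |T| = N` makes `(a, t) ↦ a + t` bijective
  have hsurj : (A ×ˢ T).image (fun z => z.1 + z.2) = Finset.univ := by
    ext x
    obtain ⟨a, ha, t, ht, rfl⟩ := hcov x
    simp only [Finset.mem_image, Finset.mem_univ, iff_true]
    exact ⟨(a, t), Finset.mk_mem_product ha ht, rfl⟩
  have hinj : Set.InjOn (fun z : ZMod N × ZMod N => z.1 + z.2) (A ×ˢ T : Finset _) := by
    rw [← Finset.card_image_iff, hsurj, Finset.card_product, hcard, Finset.card_univ, ZMod.card]
  have hAT : (∑ a ∈ A, e a) * (∑ t ∈ T, e t) = U := by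
    rw [Finset.sum_mul_sum, ← Finset.sum_product']
    simp only [he, hUdef]
    rw [← hsurj, Finset.sum_image hinj]
  have hUT : ∀ n : ℕ, U * (∑ t ∈ T, e t) ^ n = ((T.card : ZMod l) ^ n) • U := by
    intro n
    induction n with
    | zero => simp
    | succ n ih =>
      rw [pow_succ, ← mul_assoc, ih, smul_mul_assoc, Finset.mul_sum,
        Finset.sum_congr rfl fun t _ => hU t, Finset.sum_const, pow_succ, mul_smul,
        Nat.cast_smul_eq_nsmul]
  have hfrob : (∑ t ∈ T, e t) ^ l = ∑ t ∈ T, e (l • t) := by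
    have : CharP (AddMonoidAlgebra (ZMod l) (ZMod N)) l :=
      charP_of_injective_algebraMap
        (algebraMap (ZMod l) (AddMonoidAlgebra (ZMod l) (ZMod N))).injective l
    rw [sum_pow_char]
    refine Finset.sum_congr rfl fun t _ => ?_
    rw [hedef, AddMonoidAlgebra.single_pow, one_pow]
  have hmain : (∑ a ∈ A, e a) * (∑ t ∈ T, e (l • t)) = U := by
    have h0 : (T.card : ZMod l) ≠ 0 := by rwa [Ne, ZMod.natCast_eq_zero_iff]
    rw [← hfrob, ← mul_pow_sub_one hl.ne_zero, ← mul_assoc, hAT, hUT,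
      ZMod.pow_card_sub_one_eq_one h0, one_smul]
  intro x
  by_contra! hx
  have h1 := congrArg (fun f => f.coeff x) hmain
  have h2 : ∀ y, (e y).coeff x = if y = x then 1 else 0 := fun y => by
    simp [hedef, Finsupp.single_apply]
  simp only [Finset.sum_mul_sum, he, hUdef, AddMonoidAlgebra.coeff_sum, Finsupp.finsetSum_apply,
    h2] at h1
  rw [Finset.sum_eq_zero fun a ha => Finset.sum_eq_zero fun t ht => if_neg (hx a ha t ht)] at h1
  simp at h1

/-- Tijdeman's theorem: `T` may be dilated by any `n` prime to `|T|`. -/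
theorem covers_image_smul {A : Finset (ZMod N)} {m : ℕ} (hcard : A.card * m = N) (n : ℕ)
    (hn : n.Coprime m) : ∀ T : Finset (ZMod N), T.card = m →
    (∀ x : ZMod N, ∃ a ∈ A, ∃ t ∈ T, a + t = x) →
    ∀ x : ZMod N, ∃ a ∈ A, ∃ t ∈ T, a + n • t = x := by
  classical
  induction n using induction_on_primes with
  | zero =>
    intro T hT hcov x
    have hm : m = 1 := (Nat.coprime_zero_left m).1 hn
    obtain ⟨t, rfl⟩ := Finset.card_eq_one.1 (hT.trans hm)
    have hA : A = Finset.univ := by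
      rw [← Finset.card_eq_iff_eq_univ, ZMod.card]
      rwa [hm, mul_one] at hcard
    exact ⟨x, by simp [hA], t, by simp, by simp⟩
  | one => simp
  | prime_mul l n hl ih =>
    intro T hT hcov
    have hlm : ¬ l ∣ m := (hl.coprime_iff_not_dvd).1 (Nat.Coprime.coprime_mul_right hn)
    have h1 := covers_image_smul_prime hl (hT ▸ hcard) (hT ▸ hlm) hcov
    have h2 : ∀ x : ZMod N, ∃ a ∈ A, ∃ t ∈ T.image (l • ·), a + t = x := by
      intro x
      obtain ⟨a, ha, t, ht, h⟩ := h1 x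
      exact ⟨a, ha, l • t, Finset.mem_image_of_mem _ ht, h⟩
    have hle : (T.image (l • ·)).card ≤ m := hT ▸ Finset.card_image_le
    have hge : A.card * m ≤ A.card * (T.image (l • ·)).card := by
      rw [hcard, ← Finset.card_product]
      refine (ZMod.card N).symm.le.trans <| (Finset.card_le_card fun x _ => ?_).trans
        (Finset.card_image_le (f := fun z : ZMod N × ZMod N => z.1 + z.2))
      obtain ⟨a, ha, t, ht, h⟩ := h2 x
      exact Finset.mem_image.2 ⟨(a, t), Finset.mk_mem_product ha ht, h⟩
    have hA : 0 < A.card := by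
      rw [Finset.card_pos]
      obtain ⟨a, ha, -⟩ := hcov 0
      exact ⟨a, ha⟩
    intro x
    obtain ⟨a, ha, t, ht, h⟩ := ih (Nat.Coprime.coprime_mul_left hn) _
      (le_antisymm hle (Nat.le_of_mul_le_mul_left hge hA)) h2 x
    obtain ⟨t', ht', rfl⟩ := Finset.mem_image.1 ht
    exact ⟨a, ha, t', ht', by rw [mul_comm, mul_smul]; exact h⟩

theorem IsTile.exists_complement {A : Finset (ZMod N)} (h : IsTile A) : ∃ T : Finset (ZMod N),
    A.card * T.card = N ∧ ∀ x : ZMod N, ∃ a ∈ A, ∃ t ∈ T, a + t = x := by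
  obtain ⟨T, hT⟩ := h
  refine ⟨T, ?_, fun x => ?_⟩
  · rw [← Finset.card_product]
    conv_rhs => rw [← ZMod.card N, ← Finset.card_univ]
    refine Finset.card_nbij (fun z => z.1 + z.2) (fun _ _ => Finset.mem_univ _) ?_ ?_
    · rintro z hz z' hz' h
      simp only [Finset.coe_product, Set.mem_prod, Finset.mem_coe] at hz hz'
      exact (hT (z.1 + z.2)).unique ⟨hz.1, hz.2, rfl⟩ ⟨hz'.1, hz'.2, h.symm⟩
    · intro x _
      obtain ⟨z, ⟨h1, h2, h3⟩, -⟩ := hT x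
      exact ⟨z, by simp [h1, h2], h3⟩
  · obtain ⟨z, ⟨h1, h2, h3⟩, -⟩ := hT x
    exact ⟨_, h1, _, h2, h3⟩

/-- For squarefree `N`, a tile has distinct residues modulo its cardinality `k`: the complement
may be dilated by `k`, so `A` covers all residues mod `k`. -/
theorem IsTile.injOn_cast (hN : Squarefree N) {A : Finset (ZMod N)} (h : IsTile A) :
    Set.InjOn (fun x : ZMod N => (x.cast : ZMod A.card)) A := by
  classical
  obtain ⟨T, hcard, hcov⟩ := h.exists_complement
  have hdvd : A.card ∣ N := ⟨_, hcard.symm⟩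
  have : NeZero A.card := ⟨fun h => NeZero.ne N (by simpa [h] using hcard.symm)⟩
  have hcop : A.card.Coprime T.card := Nat.coprime_of_squarefree_mul (by rwa [hcard])
  have h1 := covers_image_smul hcard A.card hcop T rfl hcov
  rw [← Finset.card_image_iff]
  have : A.image (fun x : ZMod N => (x.cast : ZMod A.card)) = Finset.univ := by
    ext y
    simp only [Finset.mem_image, Finset.mem_univ, iff_true]
    obtain ⟨a, ha, t, -, h⟩ := h1 (y.val : ZMod N)
    refine ⟨a, ha, ?_⟩
    have := congrArg (fun x : ZMod N => (x.cast : ZMod A.card)) h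
    rwa [ZMod.cast_add hdvd, nsmul_eq_mul, ZMod.cast_mul hdvd, ZMod.cast_natCast hdvd,
      ZMod.cast_natCast hdvd, CharP.cast_eq_zero, zero_mul, add_zero, ZMod.natCast_zmod_val] at this
  rw [this, Finset.card_univ, ZMod.card]

/-- A complete residue system mod `k ∣ N` tiles, with the multiples of `k` as complement. -/
theorem isTile_of_injOn_cast {A : Finset (ZMod N)} (hdvd : A.card ∣ N)
    (hinj : Set.InjOn (fun x : ZMod N => (x.cast : ZMod A.card)) A) : IsTile A := by
  classical
  have : NeZero A.card := ⟨fun h => NeZero.ne N (by simpa [h] using hdvd)⟩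
  have himg : A.image (fun x : ZMod N => (x.cast : ZMod A.card)) = Finset.univ := by
    rw [← Finset.card_eq_iff_eq_univ, ZMod.card, Finset.card_image_iff]
    exact hinj
  refine ⟨Finset.univ.filter fun x : ZMod N => (x.cast : ZMod A.card) = 0, fun x => ?_⟩
  obtain ⟨a, ha, hax⟩ := Finset.mem_image.1 (himg ▸ Finset.mem_univ (x.cast : ZMod A.card))
  refine ⟨(a, x - a), ⟨ha, ?_, by simp⟩, ?_⟩
  · simp [ZMod.cast_sub hdvd, hax]
  · rintro ⟨b, t⟩ ⟨hb, ht, rfl⟩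
    have ht0 : (t.cast : ZMod A.card) = 0 := by simpa using ht
    simp only [ZMod.cast_add hdvd, ht0, add_zero] at hax
    obtain rfl := hinj ha hb hax
    simp

end Tiling

/-! ### Spectral pairs and residues modulo the cardinality -/

section Cases

theorem card_eq_sum_sum_fiber {N l m : ℕ} [NeZero l] [NeZero m] (A : Finset (ZMod N)) :
    A.card = ∑ x : ZMod l, ∑ y : ZMod m,
      (A.filter fun z => (z.cast : ZMod l) = x ∧ (z.cast : ZMod m) = y).card := by
  rw [Finset.card_eq_sum_card_fiberwise (f := fun x => (x.cast : ZMod l)) (t := Finset.univ)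
    (fun _ _ => Finset.mem_univ _)]
  refine Finset.sum_congr rfl fun x _ => ?_
  rw [Finset.card_eq_sum_card_fiberwise (f := fun x => (x.cast : ZMod m)) (t := Finset.univ)
    (fun _ _ => Finset.mem_univ _)]
  simp only [Finset.filter_filter]

variable {N : ℕ} [NeZero N]

/-- Two elements of `S` congruent mod `k` would have a difference of order `l`, and then `l ∣ k`. -/
theorem injOn_cast_of_prime_index (hN : Squarefree N) {S L : Finset (ZMod N)} {k l : ℕ}
    (hl : l.Prime) (hkl : N = k * l) (hcard : L.card = k)
    (hzero : ∀ x ∈ S, ∀ y ∈ S, x ≠ y → fourierSum L (x - y) = 0) :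
    Set.InjOn (fun x : ZMod N => (x.cast : ZMod k)) S := by
  intro x hx y hy hxy
  by_contra hne
  have hk : k ∣ N := ⟨l, hkl⟩
  have hsub : primeSupport (x - y) ⊆ {l} := by
    intro m hm
    rw [primeSupport_sub, Finset.mem_filter] at hm
    have hmp := Nat.prime_of_mem_primeFactors hm.1
    have hmN := Nat.dvd_of_mem_primeFactors hm.1
    rw [Ne, cast_eq_cast_iff_dvd hmN] at hm
    rw [Finset.mem_singleton]
    rw [hkl, hmp.dvd_mul] at hmN
    rcases hmN with h | h
    · exact absurd (h.trans ((cast_eq_cast_iff_dvd hk x y).1 hxy)) hm.2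
    · exact (Nat.prime_dvd_prime_iff_eq hmp hl).1 h
  rcases Finset.subset_singleton_iff.1 hsub with h | h
  · exact hne (sub_eq_zero.1 (eq_zero_of_primeSupport_eq_empty hN h))
  · have hlk := dvd_card_of_fourierSum_eq_zero hN (hzero x hx y hy hne) hl
      ⟨k, by rw [hkl, mul_comm]⟩ h
    rw [hcard] at hlk
    have := hN l (by rw [hkl]; exact mul_dvd_mul_right hlk l)
    exact hl.one_lt.ne' (Nat.isUnit_iff.1 this)

theorem exists_row_col_of_fourierSum_eq_zero (hN : Squarefree N) {A : Finset (ZMod N)}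
    {t : ZMod N} (h : fourierSum A t = 0) {l m : ℕ} (hlp : l.Prime) (hl : l ∣ N)
    (hmp : m.Prime) (hm : m ∣ N) (hlm : l ≠ m) (ht : primeSupport t = {l, m})
    (hlA : ¬ l ∣ A.card) (hmA : ¬ m ∣ A.card) :
    ∃ (x₀ : ZMod l) (y₀ : ZMod m) (u v : ℕ), 1 ≤ u ∧ 1 ≤ v ∧
      (A.filter fun z => (z.cast : ZMod l) = x₀ ∧ (z.cast : ZMod m) = y₀).card = u + v ∧
      (∀ y : ZMod m, u ≤ (A.filter fun z => (z.cast : ZMod l) = x₀ ∧ (z.cast : ZMod m) = y).card) ∧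
      ∀ x : ZMod l,
        v ≤ (A.filter fun z => (z.cast : ZMod l) = x ∧ (z.cast : ZMod m) = y₀).card := by
  have : NeZero l := ⟨hlp.ne_zero⟩
  have : NeZero m := ⟨hmp.ne_zero⟩
  have hsum := card_eq_sum_sum_fiber (l := l) (m := m) A
  exact exists_row_col_of_additive
    (card_filter_add_of_fourierSum_eq_zero hN h hlp hl hmp hm hlm ht)
    (by rwa [← hsum, ZMod.card]) (by rwa [← hsum, ZMod.card])

/-- If `A` misses a residue class mod `l`, then by additivity its multiplicities on `ℤ/l × ℤ/m` do
not depend on the second coordinate. -/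
theorem dvd_card_of_fiber_eq_empty (hN : Squarefree N) {A : Finset (ZMod N)}
    {t : ZMod N} (h : fourierSum A t = 0) {l m : ℕ} (hlp : l.Prime) (hl : l ∣ N)
    (hmp : m.Prime) (hm : m ∣ N) (hlm : l ≠ m) (ht : primeSupport t = {l, m})
    {x₀ : ZMod l} (hx₀ : ∀ z ∈ A, (z.cast : ZMod l) ≠ x₀) : m ∣ A.card := by
  have : NeZero l := ⟨hlp.ne_zero⟩
  have : NeZero m := ⟨hmp.ne_zero⟩
  have h0 : ∀ y : ZMod m,
      (A.filter fun z => (z.cast : ZMod l) = x₀ ∧ (z.cast : ZMod m) = y).card = 0 := fun y => by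
    rw [Finset.card_eq_zero, Finset.filter_eq_empty_iff]
    exact fun z hz h => hx₀ z hz h.1
  have h1 : ∀ (x : ZMod l) (y : ZMod m),
      (A.filter fun z => (z.cast : ZMod l) = x ∧ (z.cast : ZMod m) = y).card =
      (A.filter fun z => (z.cast : ZMod l) = x ∧ (z.cast : ZMod m) = 0).card := fun x y => by
    have := card_filter_add_of_fourierSum_eq_zero hN h hlp hl hmp hm hlm ht x x₀ y 0
    rwa [h0, h0, add_zero, add_zero] at this
  rw [card_eq_sum_sum_fiber (l := l) (m := m) A]
  refine Finset.dvd_sum fun x _ => ?_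
  rw [Finset.sum_congr rfl fun y _ => h1 x y]
  simp

/-- If any two elements of `A` agree in exactly one of three coordinates, the Fourier transform of
`A` does not vanish with support the three primes: in a box with one vertex at an element of `A`,
every element of `A` sits on a vertex of positive sign, if on any. -/
theorem not_equidistant (hN : Squarefree N) {A : Finset (ZMod N)}
    {t : ZMod N} (h : fourierSum A t = 0) {l m n : ℕ} (hlp : l.Prime) (hl : l ∣ N)
    (hmp : m.Prime) (hm : m ∣ N) (hnp : n.Prime) (hn : n ∣ N) (hlm : l ≠ m) (hln : l ≠ n)
    (hmn : m ≠ n) (ht : primeSupport t = {l, m, n}) (hA : A.Nonempty)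
    (hdist : ∀ x ∈ A, ∀ y ∈ A, x ≠ y →
      ((x.cast : ZMod l) = y.cast ∧ (x.cast : ZMod m) ≠ y.cast ∧ (x.cast : ZMod n) ≠ y.cast) ∨
      ((x.cast : ZMod l) ≠ y.cast ∧ (x.cast : ZMod m) = y.cast ∧ (x.cast : ZMod n) ≠ y.cast) ∨
      ((x.cast : ZMod l) ≠ y.cast ∧ (x.cast : ZMod m) ≠ y.cast ∧ (x.cast : ZMod n) = y.cast)) :
    False := by
  have := Fact.mk hlp
  have := Fact.mk hmp
  have := Fact.mk hnp
  obtain ⟨g, hg⟩ := hA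
  have hcube := sum_cube_of_fourierSum_eq_zero hN h hlp hl hmp hm hnp hn hlm hln hmn ht
    g.cast (g.cast + 1) g.cast (g.cast + 1) g.cast (g.cast + 1)
  refine (Finset.sum_pos' (fun x hx => ?_) ⟨g, hg, ?_⟩).ne' hcube
  · by_cases hxg : x = g
    · simp [hxg]
    · have hx := hdist x hx g hg hxg
      rcases hx with ⟨h1, h2, h3⟩ | ⟨h1, h2, h3⟩ | ⟨h1, h2, h3⟩ <;>
        simp [h1, h2, h3] <;> split_ifs <;> simp
  · simp

/-- The case `|S| = |L| = p`. If `S` is not a complete residue system mod `p`, then any two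
elements of `L` agree in exactly one of the coordinates `q`, `r`, `s`, and no zero of the Fourier
transform of `L` at a difference of two elements of `S` congruent mod `p` is compatible with this. -/
theorem injOn_cast_of_card_eq_prime {p q r s : ℕ}
    (hp : p.Prime) (hq : q.Prime) (hr : r.Prime) (hs : s.Prime)
    (hpq : p ≠ q) (hpr : p ≠ r) (hps : p ≠ s) (hqr : q ≠ r) (hqs : q ≠ s) (hrs : r ≠ s)
    (hN : Squarefree N) (hfac : N.primeFactors = {p, q, r, s}) {S L : Finset (ZMod N)}
    (hScard : S.card = p) (hLcard : L.card = p)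
    (hSzero : ∀ x ∈ L, ∀ y ∈ L, x ≠ y → fourierSum S (x - y) = 0)
    (hLzero : ∀ x ∈ S, ∀ y ∈ S, x ≠ y → fourierSum L (x - y) = 0)
    (hSN : ∀ t : ZMod N, primeSupport t = N.primeFactors → fourierSum S t ≠ 0)
    (hinj : Set.InjOn (fun x : ZMod N => (x.cast : ZMod p)) L) :
    Set.InjOn (fun x : ZMod N => (x.cast : ZMod p)) S := by
  have hpN : p ∣ N := Nat.dvd_of_mem_primeFactors (by rw [hfac]; simp)
  have hqN : q ∣ N := Nat.dvd_of_mem_primeFactors (by rw [hfac]; simp)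
  have hrN : r ∣ N := Nat.dvd_of_mem_primeFactors (by rw [hfac]; simp)
  have hsN : s ∣ N := Nat.dvd_of_mem_primeFactors (by rw [hfac]; simp)
  have : NeZero p := ⟨hp.ne_zero⟩
  have hqp : ¬ q ∣ p := fun h => hpq ((Nat.prime_dvd_prime_iff_eq hq hp).1 h).symm
  have hrp : ¬ r ∣ p := fun h => hpr ((Nat.prime_dvd_prime_iff_eq hr hp).1 h).symm
  have hsp : ¬ s ∣ p := fun h => hps ((Nat.prime_dvd_prime_iff_eq hs hp).1 h).symm
  by_contra hS
  obtain ⟨g, hg, g', hg', hgg, hne⟩ : ∃ g ∈ S, ∃ g' ∈ S,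
      (g.cast : ZMod p) = g'.cast ∧ g ≠ g' := by
    simpa only [Set.InjOn, not_forall, exists_prop, Finset.mem_coe, ne_eq] using hS
  obtain ⟨x₀, hx₀⟩ : ∃ x₀ : ZMod p, ∀ z ∈ S, (z.cast : ZMod p) ≠ x₀ := by
    by_contra! h
    refine hS (Finset.card_image_iff.1 ?_)
    have : S.image (fun x : ZMod N => (x.cast : ZMod p)) = Finset.univ := by
      ext x
      simpa using h x
    rw [this, Finset.card_univ, ZMod.card, hScard]
  have hnone : ∀ t : ZMod N, fourierSum S t = 0 → primeSupport t ≠ {p} := by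
    intro t h ht
    have hall : ∀ x : ZMod p, (S.filter fun z => (z.cast : ZMod p) = x).card = 0 := fun x => by
      rw [card_filter_eq_of_fourierSum_eq_zero hN h hp hpN ht x x₀, Finset.card_eq_zero,
        Finset.filter_eq_empty_iff]
      exact hx₀
    have := hall g.cast
    rw [Finset.card_eq_zero, Finset.filter_eq_empty_iff] at this
    exact this hg rfl
  have hpair : ∀ t : ZMod N, fourierSum S t = 0 → ∀ m : ℕ, m.Prime → m ∣ N → p ≠ m → ¬ m ∣ p →
      primeSupport t ≠ {p, m} := fun t h m hmp hm hpm hmp' ht =>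
    hmp' (hScard ▸ dvd_card_of_fiber_eq_empty hN h hp hpN hmp hm hpm ht hx₀)
  have hdist : ∀ x ∈ L, ∀ y ∈ L, x ≠ y →
      ((x.cast : ZMod q) = y.cast ∧ (x.cast : ZMod r) ≠ y.cast ∧ (x.cast : ZMod s) ≠ y.cast) ∨
      ((x.cast : ZMod q) ≠ y.cast ∧ (x.cast : ZMod r) = y.cast ∧ (x.cast : ZMod s) ≠ y.cast) ∨
      ((x.cast : ZMod q) ≠ y.cast ∧ (x.cast : ZMod r) ≠ y.cast ∧ (x.cast : ZMod s) = y.cast) := by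
    intro x hx y hy hxy
    have hp' : (x.cast : ZMod p) ≠ y.cast := fun h => hxy (hinj hx hy h)
    have h0 := hSzero x hx y hy hxy
    have hsupp := primeSupport_sub x y
    rw [hfac] at hsupp
    have e0 := hnone _ h0
    have e1 := hpair _ h0 q hq hqN hpq hqp
    have e2 := hpair _ h0 r hr hrN hpr hrp
    have e3 := hpair _ h0 s hs hsN hps hsp
    have e4 := fun h => hSN _ h h0
    rw [hsupp] at e0 e1 e2 e3 e4
    rw [hfac] at e4
    by_cases hq' : (x.cast : ZMod q) = y.cast <;> by_cases hr' : (x.cast : ZMod r) = y.cast <;>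
      by_cases hs' : (x.cast : ZMod s) = y.cast <;>
      simp [Finset.filter_insert, Finset.filter_singleton, hp', hq', hr', hs'] at e0 e1 e2 e3 e4 ⊢
  -- additivity would give two elements of `L` which agree in two coordinates
  have htwo : ∀ l m : ℕ, l.Prime → l ∣ N → m.Prime → m ∣ N → l ≠ m → ¬ l ∣ p → ¬ m ∣ p →
      (∀ x ∈ L, ∀ y ∈ L, x ≠ y → (x.cast : ZMod l) = y.cast → (x.cast : ZMod m) ≠ y.cast) →
      primeSupport (g - g') ≠ {l, m} := by
    intro l m hlp hl hmp hm hlm hlp' hmp' hL ht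
    obtain ⟨x, y, u, v, hu, hv, hw, -⟩ := exists_row_col_of_fourierSum_eq_zero hN
      (hLzero g hg g' hg' hne) hlp hl hmp hm hlm ht (hLcard ▸ hlp') (hLcard ▸ hmp')
    obtain ⟨i, hi, j, hj, hij⟩ := Finset.one_lt_card.1
      (lt_of_lt_of_eq (by omega : 1 < u + v) hw.symm)
    rw [Finset.mem_filter] at hi hj
    exact hL i hi.1 j hj.1 hij (hi.2.1.trans hj.2.1.symm) (hi.2.2.trans hj.2.2.symm)
  have hone : ∀ l : ℕ, l.Prime → l ∣ N → ¬ l ∣ p → primeSupport (g - g') ≠ {l} :=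
    fun l hlp hl hlp' ht => hlp' (hLcard ▸
      dvd_card_of_fourierSum_eq_zero hN (hLzero g hg g' hg' hne) hlp hl ht)
  have hthree : primeSupport (g - g') ≠ {q, r, s} := fun ht =>
    not_equidistant hN (hLzero g hg g' hg' hne) hq hqN hr hrN hs hsN hqr hqs hrs ht
      (Finset.card_pos.1 (hLcard ▸ hp.pos)) hdist
  have e0 : primeSupport (g - g') ≠ ∅ := fun h =>
    hne (sub_eq_zero.1 (eq_zero_of_primeSupport_eq_empty hN h))
  have e1 := hone q hq hqN hqp
  have e2 := hone r hr hrN hrp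
  have e3 := hone s hs hsN hsp
  have e4 := htwo q r hq hqN hr hrN hqr hqp hrp fun x hx y hy h => by
    have := hdist x hx y hy h; tauto
  have e5 := htwo q s hq hqN hs hsN hqs hqp hsp fun x hx y hy h => by
    have := hdist x hx y hy h; tauto
  have e6 := htwo r s hr hrN hs hsN hrs hrp hsp fun x hx y hy h => by
    have := hdist x hx y hy h; tauto
  rw [primeSupport_sub, hfac] at e0 e1 e2 e3 e4 e5 e6 hthree
  by_cases hq' : (g.cast : ZMod q) = g'.cast <;> by_cases hr' : (g.cast : ZMod r) = g'.cast <;>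
    by_cases hs' : (g.cast : ZMod s) = g'.cast <;>
    simp [Finset.filter_insert, Finset.filter_singleton, hgg, hq', hr', hs']
      at e0 e1 e2 e3 e4 e5 e6 hthree

/-- The case `|S| = |L| = p q`. The difference of two elements of `S` congruent mod `p q` can only
have support `{r, s}`, which makes the multiplicities of `L` additive on `ℤ/r × ℤ/s`, while any
two elements of `L` agree in one of the four coordinates; `card_ne_mul_of_agree` excludes this. -/
theorem injOn_cast_of_card_eq_mul {p q r s : ℕ}
    (hp : p.Prime) (hq : q.Prime) (hr : r.Prime) (hs : s.Prime)
    (hpq : p ≠ q) (hpr : p ≠ r) (hps : p ≠ s) (hqr : q ≠ r) (hqs : q ≠ s) (hrs : r ≠ s)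
    (hN : Squarefree N) (hfac : N.primeFactors = {p, q, r, s}) {S L : Finset (ZMod N)}
    (hLcard : L.card = p * q)
    (hSzero : ∀ x ∈ L, ∀ y ∈ L, x ≠ y → fourierSum S (x - y) = 0)
    (hLzero : ∀ x ∈ S, ∀ y ∈ S, x ≠ y → fourierSum L (x - y) = 0)
    (hSN : ∀ t : ZMod N, primeSupport t = N.primeFactors → fourierSum S t ≠ 0)
    (hinj : Set.InjOn (fun x : ZMod N => (x.cast : ZMod (p * q))) L) :
    Set.InjOn (fun x : ZMod N => (x.cast : ZMod (p * q))) S := by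
  have hpN : p ∣ N := Nat.dvd_of_mem_primeFactors (by rw [hfac]; simp)
  have hqN : q ∣ N := Nat.dvd_of_mem_primeFactors (by rw [hfac]; simp)
  have hrN : r ∣ N := Nat.dvd_of_mem_primeFactors (by rw [hfac]; simp)
  have hsN : s ∣ N := Nat.dvd_of_mem_primeFactors (by rw [hfac]; simp)
  have : NeZero p := ⟨hp.ne_zero⟩
  have : NeZero q := ⟨hq.ne_zero⟩
  have : NeZero r := ⟨hr.ne_zero⟩
  have : NeZero s := ⟨hs.ne_zero⟩
  have hcop : p.Coprime q := (Nat.coprime_primes hp hq).2 hpq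
  have hpqN : p * q ∣ N := hcop.mul_dvd_of_dvd_of_dvd hpN hqN
  have hcast : ∀ x y : ZMod N, (x.cast : ZMod (p * q)) = y.cast ↔
      (x.cast : ZMod p) = y.cast ∧ (x.cast : ZMod q) = y.cast := fun x y => by
    rw [cast_eq_cast_iff_dvd hpqN, cast_eq_cast_iff_dvd hpN, cast_eq_cast_iff_dvd hqN]
    exact ⟨fun h => ⟨(dvd_mul_right p q).trans h, (dvd_mul_left q p).trans h⟩,
      fun h => hcop.mul_dvd_of_dvd_of_dvd h.1 h.2⟩
  have hrL : ¬ r ∣ L.card := by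
    rw [hLcard, hr.dvd_mul, Nat.prime_dvd_prime_iff_eq hr hp, Nat.prime_dvd_prime_iff_eq hr hq]
    exact fun h => h.elim (fun h => hpr h.symm) (fun h => hqr h.symm)
  have hsL : ¬ s ∣ L.card := by
    rw [hLcard, hs.dvd_mul, Nat.prime_dvd_prime_iff_eq hs hp, Nat.prime_dvd_prime_iff_eq hs hq]
    exact fun h => h.elim (fun h => hps h.symm) (fun h => hqs h.symm)
  by_contra hS
  obtain ⟨g, hg, g', hg', hgg, hne⟩ : ∃ g ∈ S, ∃ g' ∈ S,
      (g.cast : ZMod (p * q)) = g'.cast ∧ g ≠ g' := by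
    simpa only [Set.InjOn, not_forall, exists_prop, Finset.mem_coe, ne_eq] using hS
  rw [hcast] at hgg
  have hzero := hLzero g hg g' hg' hne
  have hagree : ∀ x ∈ L, ∀ y ∈ L, (x.cast : ZMod p) = y.cast ∨ (x.cast : ZMod q) = y.cast ∨
      (x.cast : ZMod r) = y.cast ∨ (x.cast : ZMod s) = y.cast := by
    intro x hx y hy
    by_contra! h
    have hxy : x ≠ y := by rintro rfl; exact h.1 rfl
    refine hSN _ ?_ (hSzero x hx y hy hxy)
    rw [primeSupport_sub, hfac]
    simp [Finset.filter_insert, Finset.filter_singleton, h]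
  have e0 : primeSupport (g - g') ≠ ∅ := fun h =>
    hne (sub_eq_zero.1 (eq_zero_of_primeSupport_eq_empty hN h))
  have e1 : primeSupport (g - g') ≠ {r} := fun h =>
    hrL (dvd_card_of_fourierSum_eq_zero hN hzero hr hrN h)
  have e2 : primeSupport (g - g') ≠ {s} := fun h =>
    hsL (dvd_card_of_fourierSum_eq_zero hN hzero hs hsN h)
  have e3 : primeSupport (g - g') ≠ {r, s} := by
    intro ht
    obtain ⟨x₀, y₀, u, v, hu, hv, hw, hrow, hcol⟩ :=
      exists_row_col_of_fourierSum_eq_zero hN hzero hr hrN hs hsN hrs ht hrL hsL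
    have hp2 := hp.two_le
    have hq2 := hq.two_le
    have hr2 := hr.two_le
    have hs2 := hs.two_le
    -- if `r` or `s` is `2`, the counting needs `p + q ≥ 8`, so the pair `{3, 4}` has to be excluded
    have hp4 : p ≠ 4 := by rintro rfl; norm_num at hp
    have hq4 : q ≠ 4 := by rintro rfl; norm_num at hq
    refine card_ne_mul_of_agree (L := L) (a := fun z => (z.cast : ZMod p))
      (b := fun z => (z.cast : ZMod q)) (c := fun z => (z.cast : ZMod r))
      (d := fun z => (z.cast : ZMod s)) (fun x hx y hy h h' => hinj hx hy ((hcast x y).2 ⟨h, h'⟩))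
      hagree hu hv hw hrow hcol ?_ ?_ ?_ ?_ ?_ ?_ ?_ <;> simp only [ZMod.card] <;> omega
  rw [primeSupport_sub, hfac] at e0 e1 e2 e3
  by_cases hr' : (g.cast : ZMod r) = g'.cast <;> by_cases hs' : (g.cast : ZMod s) = g'.cast <;>
    simp [Finset.filter_insert, Finset.filter_singleton, hgg, hr', hs'] at e0 e1 e2 e3

end Cases

end FugledeCyclic

theorem proposition3p10 {N p q r s : ℕ} [NeZero N]
    (hp : p.Prime) (hq : q.Prime) (hr : r.Prime) (hs : s.Prime)
    (hpq : p ≠ q) (hpr : p ≠ r) (hps : p ≠ s) (hqr : q ≠ r) (hqs : q ≠ s) (hrs : r ≠ s)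
    (hN : N = p * q * r * s)
    (S L : Finset (ZMod N))
    (hSL : FugledeCyclic.IsSpectralPair S L)
    (hS : ¬ Polynomial.cyclotomic N ℚ ∣ FugledeCyclic.setMask S)
    (hL : ¬ Polynomial.cyclotomic N ℚ ∣ FugledeCyclic.setMask L)
    (htile : FugledeCyclic.IsTile L) :
    FugledeCyclic.IsTile S := by
  have hfac : N.primeFactors = {p, q, r, s} := by
    have := hp.ne_zero
    have := hq.ne_zero
    have := hr.ne_zero
    have := hs.ne_zero
    rw [hN, Nat.primeFactors_mul (by positivity) (by positivity),
      Nat.primeFactors_mul (by positivity) (by positivity),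
      Nat.primeFactors_mul (by positivity) (by positivity), hp.primeFactors, hq.primeFactors,
      hr.primeFactors, hs.primeFactors]
    ext x
    simp
  have hsq : Squarefree N := by
    have hc : ∀ {a b : ℕ}, a.Prime → b.Prime → a ≠ b → a.Coprime b := fun ha hb h =>
      (Nat.coprime_primes ha hb).2 h
    rw [hN, Nat.squarefree_mul (((hc hp hs hps).mul_left (hc hq hs hqs)).mul_left (hc hr hs hrs)),
      Nat.squarefree_mul ((hc hp hr hpr).mul_left (hc hq hr hqr)),
      Nat.squarefree_mul (hc hp hq hpq)]
    exact ⟨⟨⟨hp.squarefree, hq.squarefree⟩, hr.squarefree⟩, hs.squarefree⟩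
  have hcard : S.card = L.card := hSL.1
  have hdvd : S.card ∣ N := by
    obtain ⟨T, hT, -⟩ := htile.exists_complement
    exact ⟨_, by rw [hcard, hT]⟩
  have hinj := htile.injOn_cast hsq
  rw [← hcard] at hinj
  have hSzero : ∀ x ∈ L, ∀ y ∈ L, x ≠ y → FugledeCyclic.fourierSum S (x - y) = 0 :=
    fun x hx y hy => hSL.fourierSum_eq_zero hx hy
  have hLzero : ∀ x ∈ S, ∀ y ∈ S, x ≠ y → FugledeCyclic.fourierSum L (x - y) = 0 :=
    fun x hx y hy => hSL.symm.fourierSum_eq_zero hx hy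
  have hSN : ∀ t : ZMod N, FugledeCyclic.primeSupport t = N.primeFactors →
      FugledeCyclic.fourierSum S t ≠ 0 :=
    fun t => FugledeCyclic.fourierSum_ne_zero_of_not_dvd hsq hS
  refine FugledeCyclic.isTile_of_injOn_cast hdvd ?_
  have hLS : L.card = S.card := hcard.symm
  have hone : ∀ {a b c d : ℕ}, a.Prime → b.Prime → c.Prime → d.Prime → a ≠ b → a ≠ c → a ≠ d →
      b ≠ c → b ≠ d → c ≠ d → N.primeFactors = {a, b, c, d} → S.card = a →
      Set.InjOn (fun x : ZMod N => (x.cast : ZMod S.card)) S := by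
    intro a b c d ha hb hc hd hab hac had hbc hbd hcd hfac' hk
    rw [hk] at hLS hinj ⊢
    exact FugledeCyclic.injOn_cast_of_card_eq_prime ha hb hc hd hab hac had hbc hbd hcd hsq hfac'
      hk hLS hSzero hLzero hSN hinj
  have htwo : ∀ {a b c d : ℕ}, a.Prime → b.Prime → c.Prime → d.Prime → a ≠ b → a ≠ c → a ≠ d →
      b ≠ c → b ≠ d → c ≠ d → N.primeFactors = {a, b, c, d} → S.card = a * b →
      Set.InjOn (fun x : ZMod N => (x.cast : ZMod S.card)) S := by
    intro a b c d ha hb hc hd hab hac had hbc hbd hcd hfac' hk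
    rw [hk] at hLS hinj ⊢
    exact FugledeCyclic.injOn_cast_of_card_eq_mul ha hb hc hd hab hac had hbc hbd hcd hsq hfac'
      hLS hSzero hLzero hSN hinj
  have hthree : ∀ {l : ℕ}, l.Prime → N = S.card * l →
      Set.InjOn (fun x : ZMod N => (x.cast : ZMod S.card)) S := fun hl hk =>
    FugledeCyclic.injOn_cast_of_prime_index hsq hl hk hLS hLzero
  -- `|S|` is a product of some of the four primes
  obtain ⟨k, k₄, hk, h₄, hk4⟩ := (Nat.dvd_mul).1 (hN ▸ hdvd : S.card ∣ p * q * r * s)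
  obtain ⟨k', k₃, hk', h₃, rfl⟩ := (Nat.dvd_mul).1 hk
  obtain ⟨k₁, k₂, h₁, h₂, rfl⟩ := (Nat.dvd_mul).1 hk'
  have hperm : ∀ {A : Finset ℕ}, (∀ x, x ∈ A ↔ x = p ∨ x = q ∨ x = r ∨ x = s) →
      N.primeFactors = A := fun h => by
    ext x
    rw [h, hfac]
    simp
  rcases (Nat.dvd_prime hp).1 h₁ with h₁ | h₁ <;> rcases (Nat.dvd_prime hq).1 h₂ with h₂ | h₂ <;>
    rcases (Nat.dvd_prime hr).1 h₃ with h₃ | h₃ <;>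
    rcases (Nat.dvd_prime hs).1 h₄ with h₄ | h₄ <;>
    rw [h₁, h₂, h₃, h₄] at hk4 <;> try simp only [one_mul, mul_one] at hk4
  · intro x hx y hy _
    exact Finset.card_le_one.1 hk4.symm.le x hx y hy
  · exact hone hs hp hq hr hps.symm hqs.symm hrs.symm hpq hpr hqr
      (hperm fun x => by simp; tauto) hk4.symm
  · exact hone hr hp hq hs hpr.symm hqr.symm hrs hpq hps hqs
      (hperm fun x => by simp; tauto) hk4.symm
  · exact htwo hr hs hp hq hrs hpr.symm hqr.symm hps.symm hqs.symm hpq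
      (hperm fun x => by simp; tauto) hk4.symm
  · exact hone hq hp hr hs hpq.symm hqr hqs hpr hps hrs
      (hperm fun x => by simp; tauto) hk4.symm
  · exact htwo hq hs hp hr hqs hpq.symm hqr hps.symm hrs.symm hpr
      (hperm fun x => by simp; tauto) hk4.symm
  · exact htwo hq hr hp hs hqr hpq.symm hqs hpr.symm hrs hps
      (hperm fun x => by simp; tauto) hk4.symm
  · exact hthree hp (by rw [← hk4, hN]; ring)
  · exact hone hp hq hr hs hpq hpr hps hqr hqs hrs hfac hk4.symm
  · exact htwo hp hs hq hr hps hpq hpr hqs.symm hrs.symm hqr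
      (hperm fun x => by simp; tauto) hk4.symm
  · exact htwo hp hr hq hs hpr hpq hps hqr.symm hrs hqs
      (hperm fun x => by simp; tauto) hk4.symm
  · exact hthree hq (by rw [← hk4, hN]; ring)
  · exact htwo hp hq hr hs hpq hpr hps hqr hqs hrs hfac hk4.symm
  · exact hthree hr (by rw [← hk4, hN]; ring)
  · exact hthree hs (by rw [← hk4, hN])
  · intro x _ y _ hxy
    have h := (FugledeCyclic.cast_eq_cast_iff_dvd hdvd x y).1 hxy
    rw [← hk4, ← hN] at h
    have := Nat.eq_zero_of_dvd_of_lt h (ZMod.val_lt _)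
    exact sub_eq_zero.1 ((ZMod.val_eq_zero _).1 this)
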